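/- \textbf{Theorem.} Let $\mathbb{K}$ be a field of characteristic $0$, let $A$ be a unital associative $\mathbb{K}$-algebra (not necessarily commutative), let $\theta\in\mathbb{K}$, and let $R:A\to A$ be a Rota--Baxter map of weight $\theta$, i.e. a linear map with $R(x)R(y)=R(R(x)y)+R(xR(y))-\theta R(xy)$ for all $x,y\in A$. Extend $R$ and $\tilde R:=\theta\,\mathrm{id}-R$ coefficientwise to the power series ring $A[[t]]$ ($t$ central), complete for the filtration by the ideals $t^nA[[t]]$; exponentials and logarithms are taken in $A[[t]]$, and for $x,y\in tA[[t]]$ put $\mathrm{CBHD}(x,y):=\log(\exp(x)\exp(y))-x-y$. For $a\in A$ let $x\cdot_R y:=[x,R(y)]+\theta\,yx$, let $C_n=C^R_n(a):=R\bigl(a\cdot_R(a\cdot_R\cdots(a\cdot_R a)\cdots)\bigr)$ ($n\ge1$ factors $a$), and let $(Ra)^{[0]}:=1_A$, $(Ra)^{[n+1]}:=R\bigl(a\,(Ra)^{[n]}\bigr)$. Let Lam's exponent $K_i=K_i(x_1,\dots,x_i)$, $i\ge1$, be the noncommutative polynomial over $\mathbb{K}$ that is the coefficient of $t^i$ in $$\log\Bigl(1+\sum_{n\ge1}t^n\sum_{l=1}^{n}\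 \sum_{\substack{k_1,\dots,k_l\ge1\\k_1+\cdots+k_l=n}}\frac{x_{k_1}\cdots x_{k_l}}{k_l\,(k_{l-1}+k_l)\cdots(k_1+\cdots+k_l)}\Bigr),$$ and put $K(t):=\sum_{i>0}K_i(C_1,\dots,C_i)\,t^i\in tA[[t]]$. Then: 1. (every weight) $\ \exp(K(t))=\sum_{n\ge0}(Ra)^{[n]}t^n$. 2. ($\theta\ne0$) Let $u:=\theta^{-1}\log(1_A-\theta at)$. The $\theta$-CBHD recursion $\chi_{(0)}:=u$, $\chi_{(n+1)}:=u-\theta^{-1}\mathrm{CBHD}\bigl(\tilde R(\chi_{(n)}),R(\chi_{(n)})\bigr)$ converges in the $t$-adic topology; its limit $\chi^\theta(u)$ satisfies $\chi^\theta(u)=u-\theta^{-1}\mathrm{CBHD}\bigl(\tilde R(\chi^\theta(u)),R(\chi^\theta(u))\bigr)$ and $$\sum_{i>0}K_i(C_1,\dots,C_i)\,t^i=-R\bigl(\chi^\theta\bigl(\theta^{-1}\log(1_A-\theta at)\bigr)\bigr),$$ so that the recursion has the closed solution $\chi^\theta(u)=u+\theta^{-1}\mathrm{CBHD}\bigl(\theta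 u,K(t)\bigr)$. 3. ($\theta=0$) With $B_m$ the Bernoulli numbers ($B_1=-\tfrac12$), the weight-zero recursion $\chi_{(0)}:=at$, $\chi_{(n+1)}:=\sum_{m\ge0}\frac{B_m}{m!}\bigl(\mathrm{ad}\,R(\chi_{(n)})\bigr)^m(at)$ converges in the $t$-adic topology; its limit $\chi^0(at)$ satisfies $\chi^0(at)=\sum_{m\ge0}\frac{B_m}{m!}\bigl(\mathrm{ad}\,R(\chi^0(at))\bigr)^m(at)$ and $$\sum_{i>0}K_i(C_1,\dots,C_i)\,t^i=R\bigl(\chi^0(at)\bigr).$$ -/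

import Mathlib

open Filter PowerSeries

namespace RotaBaxter

noncomputable section

/-! Exponential, logarithm and the Campbell-Baker-Hausdorff-Dynkin series in the ring `A⟦X⟧` of
power series (in a central variable, written `t` in the comments) over a not necessarily commutative
algebra `A`. -/

section Series

variable (𝕜 : Type*) [Field 𝕜] {A : Type*} [Ring A] [Algebra 𝕜 A]

/-- The series `∑ₖ c k • f ^ k`, for `f` without constant term. The powers `f ^ k` with `k > n` do
not contribute to the coefficient of `t ^ n`. -/
def powSum (c : ℕ → 𝕜) (f : A⟦X⟧) : A⟦X⟧ :=
  PowerSeries.mk fun n => ∑ k ∈ Finset.range (n + 1), c k • coeff n (f ^ k)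

/-- `exp f = ∑ₖ f ^ k / k!`, for `f` without constant term. -/
def psExp (f : A⟦X⟧) : A⟦X⟧ :=
  powSum 𝕜 (fun k => ((k.factorial : ℕ) : 𝕜)⁻¹) f

/-- `log g = ∑_{k ≥ 1} (-1)^(k+1) / k * (g - 1) ^ k`, for `g` with constant term `1`. -/
def psLog (g : A⟦X⟧) : A⟦X⟧ :=
  powSum 𝕜 (fun k => if k = 0 then 0 else (-1) ^ (k + 1) / (k : 𝕜)) (g - 1)

/-- The part of order at least two of the Campbell-Baker-Hausdorff-Dynkin series:
`exp x * exp y = exp (x + y + CBHD x y)`. -/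
def CBHD (x y : A⟦X⟧) : A⟦X⟧ :=
  psLog 𝕜 (psExp 𝕜 x * psExp 𝕜 y) - x - y

end Series

section Limits

variable {A : Type*} [Ring A]

/-- Convergence for the filtration of `A⟦X⟧` by the ideals `t ^ N A⟦X⟧`. -/
def TAdicTendsto (s : ℕ → A⟦X⟧) (f : A⟦X⟧) : Prop :=
  ∀ N : ℕ, ∀ᶠ m in atTop, ∀ i < N, coeff i (s m) = coeff i f

/-- The limit of a sequence of power series for the `t`-adic filtration; an arbitrary series when
the sequence does not converge. -/
def tAdicLim (s : ℕ → A⟦X⟧) : A⟦X⟧ :=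
  Classical.epsilon (TAdicTendsto s)

end Limits

section RB

variable {𝕜 : Type*} [Field 𝕜] {A : Type*} [Ring A] [Algebra 𝕜 A]

/-- `R` is a Rota-Baxter map of weight `θ`. -/
def IsRotaBaxter (θ : 𝕜) (R : A →ₗ[𝕜] A) : Prop :=
  ∀ a b : A, R a * R b = R (R a * b) + R (a * R b) - θ • R (a * b)

/-- `R` acting on power series through the coefficients. -/
def onSeries (R : A →ₗ[𝕜] A) (f : A⟦X⟧) : A⟦X⟧ :=
  PowerSeries.mk fun n => R (coeff n f)

/-- The map `θ id - R`, acting on power series. -/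
def onSeriesTilde (θ : 𝕜) (R : A →ₗ[𝕜] A) (f : A⟦X⟧) : A⟦X⟧ :=
  onSeries (θ • LinearMap.id - R) f

/-- The Rota-Baxter pre-Lie product `a ·_R b = [a, R b] + θ b a`. -/
def preLieMul (θ : 𝕜) (R : A →ₗ[𝕜] A) (a b : A) : A :=
  a * R b - R b * a + θ • (b * a)

/-- The right-nested pre-Lie product `a ·_R (a ·_R (⋯ (a ·_R a)))` with `n ≥ 1` factors. -/
def preLiePow (θ : 𝕜) (R : A →ₗ[𝕜] A) (a : A) : ℕ → A
  | 0 => 0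
  | 1 => a
  | n + 2 => preLieMul θ R a (preLiePow θ R a (n + 1))

/-- The pre-Lie words `C n = R (a ·_R (a ·_R (⋯ (a ·_R a))))`, for `n ≥ 1`. -/
def preLieWord (θ : 𝕜) (R : A →ₗ[𝕜] A) (a : A) (n : ℕ) : A :=
  R (preLiePow θ R a n)

/-- The Rota-Baxter words `1, R a, R (a * R a), R (a * R (a * R a)), …`. -/
def rbWord (R : A →ₗ[𝕜] A) (a : A) : ℕ → A
  | 0 => 1
  | n + 1 => R (a * rbWord R a n)

/-- The approximations `χ₍₀₎(u) = u`, `χ₍ₙ₊₁₎(u) = u - θ⁻¹ CBHD ((θ id - R) χ₍ₙ₎(u), R χ₍ₙ₎(u))`. -/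
def chiIter (θ : 𝕜) (R : A →ₗ[𝕜] A) (u : A⟦X⟧) : ℕ → A⟦X⟧
  | 0 => u
  | n + 1 => u - θ⁻¹ • CBHD 𝕜 (onSeriesTilde θ R (chiIter θ R u n)) (onSeries R (chiIter θ R u n))

/-- The `θ`-CBHD recursion `χ^θ`, for `θ ≠ 0`. -/
def chi (θ : 𝕜) (R : A →ₗ[𝕜] A) (u : A⟦X⟧) : A⟦X⟧ :=
  tAdicLim (chiIter θ R u)

/-- `(ad x / (exp (ad x) - 1)) u = ∑ₘ (Bₘ / m!) (ad x)^m u`, for `x` without constant term; the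
terms with `m > n` do not contribute to the coefficient of `t ^ n`. -/
def adBernoulli (𝕜 : Type*) [Field 𝕜] {A : Type*} [Ring A] [Algebra 𝕜 A] (x u : A⟦X⟧) : A⟦X⟧ :=
  PowerSeries.mk fun n => ∑ m ∈ Finset.range (n + 1),
    (((bernoulli m / (m.factorial : ℚ) : ℚ)) : 𝕜) • coeff n ((fun y => x * y - y * x)^[m] u)

/-- The approximations to the solution of the weight-zero recursion. -/
def chiZeroIter (R : A →ₗ[𝕜] A) (u : A⟦X⟧) : ℕ → A⟦X⟧
  | 0 => u
  | n + 1 => adBernoulli 𝕜 (onSeries R (chiZeroIter R u n)) u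

/-- The weight-zero CBHD recursion `χ⁰`. -/
def chiZero (R : A →ₗ[𝕜] A) (u : A⟦X⟧) : A⟦X⟧ :=
  tAdicLim (chiZeroIter R u)

end RB

section Lam

variable (𝕜 : Type*) [Field 𝕜]

/-- `1 / (kₗ (kₗ₋₁ + kₗ) ⋯ (k₁ + ⋯ + kₗ))` for the list `[k₁, …, kₗ]`. -/
def compWeight : List ℕ → 𝕜
  | [] => 1
  | k :: ks => ((k + ks.sum : ℕ) : 𝕜)⁻¹ * compWeight ks

/-- The generators `x₁, …, xᵢ` of the free associative algebra in `i` variables. -/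
def lamVar (i j : ℕ) : FreeAlgebra 𝕜 (Fin i) :=
  if h : 1 ≤ j ∧ j ≤ i then FreeAlgebra.ι 𝕜 ⟨j - 1, by omega⟩ else 0

/-- Coefficient of `t ^ n`: the sum over all compositions `(k₁, …, kₗ)` of `n` of
`x_{k₁} ⋯ x_{kₗ} / (kₗ (kₗ₋₁ + kₗ) ⋯ (k₁ + ⋯ + kₗ))`. -/
def lamSeries (i : ℕ) : (FreeAlgebra 𝕜 (Fin i))⟦X⟧ :=
  PowerSeries.mk fun n =>
    ∑ c : Composition n, compWeight 𝕜 c.blocks • (c.blocks.map (lamVar 𝕜 i)).prod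

/-- Lam's exponent `Kᵢ` as a noncommutative polynomial in the variables `x₁, …, xᵢ`: the coefficient
of `t ^ i` in the logarithm of `lamSeries`. -/
def lamPoly (i : ℕ) : FreeAlgebra 𝕜 (Fin i) :=
  coeff i (psLog 𝕜 (lamSeries 𝕜 i))

/-- `Kᵢ (C 1, …, C i)`. -/
def lamK {𝕜 : Type*} [Field 𝕜] {A : Type*} [Ring A] [Algebra 𝕜 A] (C : ℕ → A) (i : ℕ) : A :=
  FreeAlgebra.lift 𝕜 (fun j : Fin i => C (j + 1)) (lamPoly 𝕜 i)

/-- `∑_{i > 0} Kᵢ (C 1, …, C i) t ^ i`. -/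
def lamKSeries (𝕜 : Type*) [Field 𝕜] {A : Type*} [Ring A] [Algebra 𝕜 A] (C : ℕ → A) : A⟦X⟧ :=
  PowerSeries.mk fun i => if i = 0 then 0 else lamK (𝕜 := 𝕜) C i

end Lam

end

end RotaBaxter

/-! Write W for the generating series of the Rota-Baxter words. It is the unique solution of W = 1 +
R(atW), and it also satisfies t W' = (∑ C_n t^n) W. Solving this linear equation degree by degree
produces one term per composition, with exactly Lam's weights, so W is Lam's series and exp K = W.

For the recursions, the double product x ∗ y = R(x)y + xR(y) - θxy is the key: R is multiplicative
from ∗ to the ordinary product, and so is R - θ, which has the same double product. Hence, with E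
the ∗-exponential of x without its unit, exp(Rx) = 1 + R(E) and exp(Rx - θx) = 1 + R(E) - θE.

If θ ≠ 0, the fixed-point equation means exp(R̃χ) exp(Rχ) = 1 - θat. Taking x = -χ gives E = at
exp(-Rχ), so exp(-Rχ) solves the equation of W, and injectivity of exp gives K = -R(χ). Rewriting
the factorization as exp(R̃χ) = exp(θu) exp(K) gives the closed solution.

If θ = 0 and x = χ, then E = ((exp(ad Rχ) - 1)/ad Rχ)(χ) exp(Rχ). The Bernoulli series inverts the
operator, so E = at exp(Rχ) and exp(Rχ) = W.

Both recursions converge because their maps gain one power of t. Identities between functions of a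
single series are transported from 𝕜⟦X⟧. -/

namespace RotaBaxter

/-! ### Congruence modulo powers of t and fixed points. -/

section EqBelow

variable {A : Type*} [Ring A]

/-- `f` and `g` agree modulo `t ^ N`. -/
def EqBelow (N : ℕ) (f g : A⟦X⟧) : Prop :=
  ∀ i < N, coeff i f = coeff i g

theorem EqBelow.refl (N : ℕ) (f : A⟦X⟧) : EqBelow N f f := fun _ _ => rfl

theorem EqBelow.symm {N : ℕ} {f g : A⟦X⟧} (h : EqBelow N f g) : EqBelow N g f :=
  fun i hi => (h i hi).symm

theorem EqBelow.trans {N : ℕ} {f g k : A⟦X⟧} (h : EqBelow N f g) (h' : EqBelow N g k) :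
    EqBelow N f k :=
  fun i hi => (h i hi).trans (h' i hi)

theorem EqBelow.mono {M N : ℕ} {f g : A⟦X⟧} (h : EqBelow N f g) (hM : M ≤ N) : EqBelow M f g :=
  fun i hi => h i (hi.trans_le hM)

theorem EqBelow.add {N : ℕ} {f f' g g' : A⟦X⟧} (h : EqBelow N f f') (h' : EqBelow N g g') :
    EqBelow N (f + g) (f' + g') := fun i hi => by simp [h i hi, h' i hi]

theorem EqBelow.sub {N : ℕ} {f f' g g' : A⟦X⟧} (h : EqBelow N f f') (h' : EqBelow N g g') :
    EqBelow N (f - g) (f' - g') := fun i hi => by simp [h i hi, h' i hi]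

theorem EqBelow.smul {𝕜 : Type*} [Field 𝕜] [Algebra 𝕜 A] {N : ℕ} {f g : A⟦X⟧} (c : 𝕜)
    (h : EqBelow N f g) : EqBelow N (c • f) (c • g) := fun i hi => by
  simp [h i hi]

theorem EqBelow.sum {ι : Type*} {N : ℕ} {s : Finset ι} {f g : ι → A⟦X⟧}
    (h : ∀ i ∈ s, EqBelow N (f i) (g i)) : EqBelow N (∑ i ∈ s, f i) (∑ i ∈ s, g i) :=
  fun i hi => by simpa using Finset.sum_congr rfl fun j hj => h j hj i hi

theorem EqBelow.mul {N : ℕ} {f f' g g' : A⟦X⟧} (h : EqBelow N f f') (h' : EqBelow N g g') :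
    EqBelow N (f * g) (f' * g') := fun i hi => by
  simp only [coeff_mul]
  refine Finset.sum_congr rfl fun p hp => ?_
  rw [Finset.HasAntidiagonal.mem_antidiagonal] at hp
  rw [h _ (by omega), h' _ (by omega)]

theorem EqBelow.pow {N : ℕ} {f f' : A⟦X⟧} (h : EqBelow N f f') (k : ℕ) :
    EqBelow N (f ^ k) (f' ^ k) := by
  induction k with
  | zero => simpa using EqBelow.refl N 1
  | succ k ih => simpa only [pow_succ] using ih.mul h

theorem EqBelow.mul_of_left {N : ℕ} {f g g' : A⟦X⟧} (hf : constantCoeff f = 0)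
    (h : EqBelow N g g') : EqBelow (N + 1) (f * g) (f * g') := fun i hi => by
  simp only [coeff_mul]
  refine Finset.sum_congr rfl fun p hp => ?_
  rw [Finset.HasAntidiagonal.mem_antidiagonal] at hp
  rcases Nat.eq_zero_or_pos p.1 with h0 | h0
  · simp [h0, hf]
  · rw [h _ (by omega)]

theorem EqBelow.mul_of_right {N : ℕ} {f f' g : A⟦X⟧} (hg : constantCoeff g = 0)
    (h : EqBelow N f f') : EqBelow (N + 1) (f * g) (f' * g) := fun i hi => by
  simp only [coeff_mul]
  refine Finset.sum_congr rfl fun p hp => ?_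
  rw [Finset.HasAntidiagonal.mem_antidiagonal] at hp
  rcases Nat.eq_zero_or_pos p.2 with h0 | h0
  · simp [h0, hg]
  · rw [h _ (by omega)]

theorem EqBelow.mul_succ {N : ℕ} {f f' g g' : A⟦X⟧} (hf : constantCoeff f' = 0)
    (hg : constantCoeff g = 0) (h : EqBelow N f f') (h' : EqBelow N g g') :
    EqBelow (N + 1) (f * g) (f' * g') :=
  (EqBelow.mul_of_right hg h).trans (EqBelow.mul_of_left hf h')

theorem eqBelow_one {f g : A⟦X⟧} (hf : constantCoeff f = 0) (hg : constantCoeff g = 0) :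
    EqBelow 1 f g := fun i hi => by
  obtain rfl : i = 0 := by omega
  simp [hf, hg]

theorem EqBelow.constantCoeff_eq {N : ℕ} {f g : A⟦X⟧} (h : EqBelow (N + 1) f g) :
    constantCoeff f = constantCoeff g := by
  simpa using h 0 (by omega)

theorem eq_of_eqBelow {f g : A⟦X⟧} (h : ∀ N, EqBelow N f g) : f = g :=
  PowerSeries.ext fun n => h (n + 1) n (by omega)

/-- The form in which uniqueness is used: two solutions of an equation that gains a power of t
coincide. Agreement modulo t^0 is vacuous, so no base case is needed. -/
theorem eq_of_eqBelow_succ {f g : A⟦X⟧} (h : ∀ N, EqBelow N f g → EqBelow (N + 1) f g) : f = g := by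
  refine eq_of_eqBelow fun N => ?_
  induction N with
  | zero => exact fun i hi => by omega
  | succ N ih => exact h N ih

/-- A map that gains one power of `t` has a fixed point, the limit of its iterates. -/
theorem tendsto_tAdicLim_and_fixed {F : A⟦X⟧ → A⟦X⟧} {s : ℕ → A⟦X⟧}
    (hF0 : ∀ f, constantCoeff f = 0 → constantCoeff (F f) = 0)
    (hF : ∀ N f g, constantCoeff f = 0 → constantCoeff g = 0 → EqBelow N f g →
      EqBelow (N + 1) (F f) (F g))
    (hs0 : constantCoeff (s 0) = 0) (hs : ∀ n, s (n + 1) = F (s n)) :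
    TAdicTendsto s (tAdicLim s) ∧ constantCoeff (tAdicLim s) = 0 ∧
      tAdicLim s = F (tAdicLim s) := by
  have h0 : ∀ n, constantCoeff (s n) = 0 := by
    intro n
    induction n with
    | zero => exact hs0
    | succ n ih => rw [hs]; exact hF0 _ ih
  have h1 : ∀ n, EqBelow (n + 1) (s n) (s (n + 1)) := by
    intro n
    induction n with
    | zero => exact eqBelow_one (h0 _) (h0 _)
    | succ n ih =>
      rw [hs n, hs (n + 1)]
      exact hF _ _ _ (h0 _) (h0 _) (hs n ▸ ih)
  have h2 : ∀ n k, EqBelow (n + 1) (s n) (s (n + k)) := by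
    intro n k
    induction k with
    | zero => exact EqBelow.refl _ _
    | succ k ih => exact ih.trans ((h1 (n + k)).mono (by omega))
  -- The diagonal series is the limit, since the coefficient of index n is stationary from the n-th
  -- iterate on.
  have hlim : TAdicTendsto s (PowerSeries.mk fun n => coeff n (s n)) := by
    intro N
    filter_upwards [eventually_ge_atTop N] with m hm i hi
    obtain ⟨k, rfl⟩ := Nat.exists_eq_add_of_le (hi.le.trans hm)
    rw [coeff_mk]
    exact (h2 i k i (by omega)).symm
  have hL : TAdicTendsto s (tAdicLim s) := Classical.epsilon_spec ⟨_, hlim⟩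
  have hL0 : constantCoeff (tAdicLim s) = 0 := by
    obtain ⟨m, hm⟩ := (hL 1).exists
    have := hm 0 (by omega)
    simp only [coeff_zero_eq_constantCoeff, h0] at this
    exact this.symm
  refine ⟨hL, hL0, eq_of_eqBelow fun N => ?_⟩
  obtain ⟨m, hm⟩ := eventually_atTop.1 (hL N)
  have e1 : EqBelow N (s m) (tAdicLim s) := hm m le_rfl
  have e2 : EqBelow N (s (m + 1)) (tAdicLim s) := hm (m + 1) (by omega)
  rw [hs] at e2
  exact e2.symm.trans ((hF _ _ _ (h0 m) hL0 e1).mono (by omega))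

end EqBelow

/-! ### Functional calculus for operators that gain a power of t. -/

section OpSum

variable {𝕜 : Type*} [Field 𝕜] {A : Type*} [Ring A] [Algebra 𝕜 A]

/-- The series `∑ₖ c k • T ^ k v`, for a linear map `T` that gains a power of `t`. -/
noncomputable def opSum (c : ℕ → 𝕜) (T : Module.End 𝕜 A⟦X⟧) (v : A⟦X⟧) : A⟦X⟧ :=
  PowerSeries.mk fun n => ∑ k ∈ Finset.range (n + 1), c k • coeff n ((T ^ k) v)

/-- `T` gains a power of `t`. -/
def Raises (T : Module.End 𝕜 A⟦X⟧) : Prop :=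
  ∀ N f g, EqBelow N f g → EqBelow (N + 1) (T f) (T g)

theorem Raises.pow {T : Module.End 𝕜 A⟦X⟧} (hT : Raises T) {N : ℕ} {f g : A⟦X⟧}
    (h : EqBelow N f g) (k : ℕ) : EqBelow (N + k) ((T ^ k) f) ((T ^ k) g) := by
  induction k with
  | zero => simpa using h
  | succ k ih =>
    simp only [pow_succ', Module.End.mul_apply]
    exact hT _ _ _ ih

theorem Raises.coeff_pow_eq_zero {T : Module.End 𝕜 A⟦X⟧} (hT : Raises T) (v : A⟦X⟧) {n k : ℕ}
    (h : n < k) : coeff n ((T ^ k) v) = 0 := by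
  have := hT.pow (N := 0) (f := v) (g := 0) (fun i hi => by omega) k n (by omega)
  simpa using this

theorem raises_mulLeft {f : A⟦X⟧} (hf : constantCoeff f = 0) :
    Raises (LinearMap.mulLeft 𝕜 f) := fun _ _ _ h => h.mul_of_left hf

theorem raises_ad {f : A⟦X⟧} (hf : constantCoeff f = 0) :
    Raises (LinearMap.mulLeft 𝕜 f - LinearMap.mulRight 𝕜 f) := fun _ _ _ h =>
  (h.mul_of_left hf).sub (h.mul_of_right hf)

theorem opSum_eqBelow (c : ℕ → 𝕜) {T : Module.End 𝕜 A⟦X⟧} (hT : Raises T) (v : A⟦X⟧) {N M : ℕ}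
    (h : N ≤ M) : EqBelow N (opSum c T v) (∑ k ∈ Finset.range M, c k • (T ^ k) v) := by
  intro n hn
  rw [opSum, coeff_mk, map_sum]
  simp only [coeff_smul]
  refine Finset.sum_subset (fun k hk => ?_) fun k _ hk => ?_
  · simp only [Finset.mem_range] at *; omega
  · rw [hT.coeff_pow_eq_zero v (by simpa using hk), smul_zero]

theorem sum_range_sum_range_eq_sum_antidiagonal {M : Type*} [AddCommMonoid M] (n : ℕ)
    (g : ℕ → ℕ → M) (hg : ∀ i j, n < i + j → g i j = 0) :
    ∑ i ∈ Finset.range (n + 1), ∑ j ∈ Finset.range (n + 1), g i j =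
      ∑ k ∈ Finset.range (n + 1), ∑ p ∈ Finset.HasAntidiagonal.antidiagonal k, g p.1 p.2 := by
  simp only [Finset.Nat.sum_antidiagonal_eq_sum_range_succ (fun i j => g i j)]
  rw [Finset.sum_range_diag_flip]
  refine Finset.sum_congr rfl fun i _ => (Finset.sum_subset (fun k hk => ?_) fun k _ hk => ?_).symm
  · simp only [Finset.mem_range] at *; omega
  · simp only [Finset.mem_range] at *
    exact hg _ _ (by omega)

/-- Only powers of the single operator `T` occur, and they commute. The calculus is therefore
multiplicative in the scalar series even though `A` is not commutative. -/
theorem opSum_mul (p q : 𝕜⟦X⟧) {T : Module.End 𝕜 A⟦X⟧} (hT : Raises T) (v : A⟦X⟧) :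
    opSum (fun n => coeff n (p * q)) T v =
      opSum (fun n => coeff n p) T (opSum (fun n => coeff n q) T v) := by
  ext n
  have h : coeff n (opSum (fun n => coeff n p) T (opSum (fun n => coeff n q) T v)) =
      ∑ i ∈ Finset.range (n + 1), ∑ j ∈ Finset.range (n + 1),
        (coeff i p * coeff j q) • coeff n ((T ^ (i + j)) v) := by
    rw [opSum, coeff_mk]
    refine Finset.sum_congr rfl fun i _ => ?_
    have := (hT.pow (opSum_eqBelow (fun n => coeff n q) hT v (le_refl (n + 1))) i) n (by omega)
    rw [this]
    simp only [map_sum, map_smul, coeff_smul, Finset.smul_sum, smul_smul, pow_add,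
      Module.End.mul_apply]
  rw [h, sum_range_sum_range_eq_sum_antidiagonal, opSum, coeff_mk]
  · refine Finset.sum_congr rfl fun k _ => ?_
    rw [coeff_mul, Finset.sum_smul]
    refine Finset.sum_congr rfl fun p hp => ?_
    rw [Finset.HasAntidiagonal.mem_antidiagonal.1 hp]
  · intro i j hij
    rw [hT.coeff_pow_eq_zero v hij, smul_zero]

theorem opSum_coeff_one {T : Module.End 𝕜 A⟦X⟧} (v : A⟦X⟧) :
    opSum (fun n => coeff n (1 : 𝕜⟦X⟧)) T v = v := by
  ext n
  simp [opSum, coeff_one]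

end OpSum

/-! ### Substitution of a series without constant term into a scalar series. -/

section PowSum

variable {𝕜 : Type*} [Field 𝕜] {A : Type*} [Ring A] [Algebra 𝕜 A]

theorem powSum_eq_opSum (c : ℕ → 𝕜) (f : A⟦X⟧) :
    powSum 𝕜 c f = opSum c (LinearMap.mulLeft 𝕜 f) 1 := by
  simp [powSum, opSum, LinearMap.pow_mulLeft]

theorem opSum_mulLeft (c : ℕ → 𝕜) {f : A⟦X⟧} (hf : constantCoeff f = 0) (v : A⟦X⟧) :
    opSum c (LinearMap.mulLeft 𝕜 f) v = powSum 𝕜 c f * v := by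
  refine eq_of_eqBelow fun N => ?_
  refine (opSum_eqBelow c (raises_mulLeft hf) v le_rfl).trans ?_
  rw [powSum_eq_opSum]
  refine EqBelow.trans ?_ ((opSum_eqBelow c (raises_mulLeft hf) 1 le_rfl).symm.mul
    (EqBelow.refl N v))
  simp only [LinearMap.pow_mulLeft, LinearMap.mulLeft_apply, mul_one, Finset.sum_mul,
    smul_mul_assoc]
  exact EqBelow.refl _ _

theorem powSum_mul (p q : 𝕜⟦X⟧) {f : A⟦X⟧} (hf : constantCoeff f = 0) :
    powSum 𝕜 (fun n => coeff n (p * q)) f =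
      powSum 𝕜 (fun n => coeff n p) f * powSum 𝕜 (fun n => coeff n q) f := by
  rw [← opSum_mulLeft _ hf, powSum_eq_opSum, powSum_eq_opSum, opSum_mul _ _ (raises_mulLeft hf)]

theorem powSum_coeff_one (f : A⟦X⟧) : powSum 𝕜 (fun n => coeff n (1 : 𝕜⟦X⟧)) f = 1 := by
  rw [powSum_eq_opSum, opSum_coeff_one]

theorem powSum_pow (p : 𝕜⟦X⟧) {f : A⟦X⟧} (hf : constantCoeff f = 0) (k : ℕ) :
    powSum 𝕜 (fun n => coeff n (p ^ k)) f = powSum 𝕜 (fun n => coeff n p) f ^ k := by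
  induction k with
  | zero => simpa using powSum_coeff_one f
  | succ k ih => simp only [pow_succ, powSum_mul _ _ hf, ih]

theorem powSum_eqBelow (c : ℕ → 𝕜) {f : A⟦X⟧} (hf : constantCoeff f = 0) {N M : ℕ} (h : N ≤ M) :
    EqBelow N (powSum 𝕜 c f) (∑ k ∈ Finset.range M, c k • f ^ k) := by
  rw [powSum_eq_opSum]
  simpa [LinearMap.pow_mulLeft] using opSum_eqBelow c (raises_mulLeft hf) 1 h

theorem powSum_congr (c : ℕ → 𝕜) {N : ℕ} {f g : A⟦X⟧} (h : EqBelow N f g) :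
    EqBelow N (powSum 𝕜 c f) (powSum 𝕜 c g) := by
  intro n hn
  simp only [powSum, coeff_mk]
  exact Finset.sum_congr rfl fun k _ => by rw [h.pow k n hn]

theorem constantCoeff_powSum (c : ℕ → 𝕜) (f : A⟦X⟧) :
    constantCoeff (powSum 𝕜 c f) = c 0 • 1 := by
  rw [← coeff_zero_eq_constantCoeff_apply, powSum, coeff_mk]
  simp

/-- Associativity of substitution; it reduces the relation between exp and log over `A` to one in
𝕜⟦X⟧. -/
theorem powSum_powSum (c : ℕ → 𝕜) {p : 𝕜⟦X⟧} (hp : constantCoeff p = 0) {f : A⟦X⟧}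
    (hf : constantCoeff f = 0) :
    powSum 𝕜 c (powSum 𝕜 (fun n => coeff n p) f) =
      powSum 𝕜 (fun n => coeff n (powSum 𝕜 c p)) f := by
  refine eq_of_eqBelow fun N => ?_
  refine (powSum_eqBelow c (by simp [constantCoeff_powSum, hp]) le_rfl).trans ?_
  simp only [← powSum_pow p hf]
  intro n hn
  simp only [powSum, map_sum, coeff_smul, coeff_mk, Finset.smul_sum, smul_smul]
  rw [Finset.sum_comm]
  refine Finset.sum_congr rfl fun k hk => ?_
  rw [← Finset.sum_smul]
  congr 1
  have := powSum_eqBelow c hp (le_refl N) k (by simp only [Finset.mem_range] at hk; omega)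
  simpa [powSum] using this.symm

end PowSum

/-! ### Exponential, logarithm and the CBHD series. -/

section ExpLog

variable {𝕜 : Type*} [Field 𝕜] {A : Type*} [Ring A] [Algebra 𝕜 A]

theorem constantCoeff_psExp (f : A⟦X⟧) : constantCoeff (psExp 𝕜 f) = 1 := by
  simp [psExp, constantCoeff_powSum]

theorem constantCoeff_psLog (g : A⟦X⟧) : constantCoeff (psLog 𝕜 g) = 0 := by
  simp [psLog, constantCoeff_powSum]

theorem psExp_congr {N : ℕ} {f g : A⟦X⟧} (h : EqBelow N f g) :
    EqBelow N (psExp 𝕜 f) (psExp 𝕜 g) := powSum_congr _ h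

theorem psLog_congr {N : ℕ} {f g : A⟦X⟧} (h : EqBelow N f g) :
    EqBelow N (psLog 𝕜 f) (psLog 𝕜 g) := powSum_congr _ (h.sub (EqBelow.refl N 1))

/-- The part of order at least two of the exponential series gains a power of `t`. -/
theorem psExp_sub_congr {N : ℕ} {f g : A⟦X⟧} (hf : constantCoeff f = 0) (hg : constantCoeff g = 0)
    (h : EqBelow N f g) : EqBelow (N + 1) (psExp 𝕜 f - 1 - f) (psExp 𝕜 g - 1 - g) := by
  have key : ∀ f : A⟦X⟧, constantCoeff f = 0 → EqBelow (N + 1) (psExp 𝕜 f - 1 - f)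
      (∑ k ∈ Finset.range (N + 1), (((k + 1 + 1).factorial : ℕ) : 𝕜)⁻¹ • f ^ (k + 1 + 1)) := by
    intro f hf
    have := ((powSum_eqBelow (fun k => ((k.factorial : ℕ) : 𝕜)⁻¹) hf
      (show N + 1 ≤ N + 1 + 1 + 1 by omega)).sub (EqBelow.refl _ 1)).sub (EqBelow.refl _ f)
    rw [Finset.sum_range_succ', Finset.sum_range_succ'] at this
    simpa [psExp] using this
  refine (key f hf).trans (EqBelow.trans (EqBelow.sum fun k _ => ?_) (key g hg).symm)
  refine EqBelow.smul _ ?_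
  rw [pow_succ, pow_succ g]
  exact EqBelow.mul_succ (by simp [hg]) hf (h.pow _) h

/-- Since f = (exp f - 1) - (exp f - 1 - f), where the last bracket gains a power of t, equal
exponentials improve any agreement by one degree. -/
theorem psExp_injective {f g : A⟦X⟧} (hf : constantCoeff f = 0) (hg : constantCoeff g = 0)
    (h : psExp 𝕜 f = psExp 𝕜 g) : f = g := by
  refine eq_of_eqBelow_succ fun N hN => ?_
  have := (EqBelow.refl (N + 1) (psExp 𝕜 f - 1)).sub (psExp_sub_congr (𝕜 := 𝕜) hf hg hN)
  rw [sub_sub_cancel] at this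
  refine this.trans ?_
  rw [h, sub_sub_cancel]
  exact EqBelow.refl _ _

theorem psExp_mul_psExp_neg [CharZero 𝕜] {f : A⟦X⟧} (hf : constantCoeff f = 0) :
    psExp 𝕜 f * psExp 𝕜 (-f) = 1 := by
  have h1 : ∀ f : A⟦X⟧, psExp 𝕜 f = powSum 𝕜 (fun n => coeff n (PowerSeries.exp 𝕜)) f := by
    intro f
    simp [psExp, coeff_exp]
  have h2 : psExp 𝕜 (-f) = powSum 𝕜 (fun n => coeff n (evalNegHom (PowerSeries.exp 𝕜))) f := by
    ext n
    simp only [h1, powSum, coeff_mk, evalNegHom, coeff_rescale]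
    refine Finset.sum_congr rfl fun k _ => ?_
    rcases Nat.even_or_odd k with hk | hk
    · simp [hk.neg_pow]
    · simp [hk.neg_pow]
  rw [h2, h1, ← powSum_mul _ _ hf, exp_mul_exp_neg_eq_one, powSum_coeff_one]

theorem derivative_psExp [CharZero 𝕜] {p : 𝕜⟦X⟧} (hp : constantCoeff p = 0) :
    derivative 𝕜 (psExp 𝕜 p) = psExp 𝕜 p * derivative 𝕜 p := by
  refine eq_of_eqBelow fun N => ?_
  have h1 := powSum_eqBelow (fun k => ((k.factorial : ℕ) : 𝕜)⁻¹) hp (le_refl (N + 1))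
  have h2 := (powSum_eqBelow (fun k => ((k.factorial : ℕ) : 𝕜)⁻¹) hp (le_refl N)).mul
    (EqBelow.refl N (derivative 𝕜 p))
  refine EqBelow.trans (fun i hi => ?_) h2.symm
  rw [coeff_derivative, psExp, h1 (i + 1) (by omega), ← coeff_derivative, Finset.sum_range_succ',
    Finset.sum_mul, map_add, map_sum, pow_zero, Derivation.map_smul, Derivation.map_one_eq_zero,
    smul_zero, add_zero]
  refine congrArg (coeff i) ?_
  refine Finset.sum_congr rfl fun k _ => ?_
  rw [Derivation.map_smul, derivative_pow, Nat.factorial_succ, add_tsub_cancel_right, mul_assoc,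
    ← nsmul_eq_mul, ← Nat.cast_smul_eq_nsmul 𝕜, smul_smul, smul_mul_assoc]
  congr 1
  have : ((k : 𝕜) + 1) ≠ 0 := by exact_mod_cast k.succ_ne_zero
  push_cast
  field_simp

/-- E = exp(log(1 + X)) satisfies (1 + X)E' = E and E(0) = 1, which determines its coefficients. -/
theorem psExp_psLog_one_add_X [CharZero 𝕜] : psExp 𝕜 (psLog 𝕜 (1 + X : 𝕜⟦X⟧)) = 1 + X := by
  set l : 𝕜⟦X⟧ := psLog 𝕜 (1 + X) with hl
  have hl0 : constantCoeff l = 0 := constantCoeff_psLog _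
  have hc : ∀ n, coeff n l = if n = 0 then 0 else (-1) ^ (n + 1) / (n : 𝕜) := by
    intro n
    rw [hl, psLog, add_sub_cancel_left]
    simp [powSum, coeff_X_pow]
  have hd : (1 + X) * derivative 𝕜 l = 1 := by
    ext n
    rw [add_mul, one_mul, map_add]
    have hdc : ∀ n, coeff n (derivative 𝕜 l) = (-1) ^ n := by
      intro n
      have : ((n : 𝕜) + 1) ≠ 0 := by exact_mod_cast n.succ_ne_zero
      rw [coeff_derivative, hc]
      simp [pow_succ]
      field_simp
    cases n with
    | zero => simp [hdc]
    | succ n => rw [coeff_succ_X_mul, hdc, hdc, coeff_one]; simp [pow_succ]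
  have hE : (1 + X) * derivative 𝕜 (psExp 𝕜 l) = psExp 𝕜 l := by
    rw [derivative_psExp hl0, mul_left_comm, hd, mul_one]
  set E := psExp 𝕜 l
  have h0 : coeff 0 E = 1 := by simpa using constantCoeff_psExp (𝕜 := 𝕜) l
  -- The factor n on the right vanishes at n = 0; this kills the coefficient of X^2, and then all
  -- later ones.
  have hrec : ∀ n, coeff (n + 1 + 1) E * (n + 1 + 1) = - (n * coeff (n + 1) E) := by
    intro n
    have := congrArg (coeff (n + 1)) hE
    rw [add_mul, one_mul, map_add, coeff_succ_X_mul, coeff_derivative, coeff_derivative] at this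
    push_cast at this
    linear_combination this
  have h1 : coeff 1 E = 1 := by
    have := congrArg (coeff 0) hE
    rw [add_mul, one_mul, map_add, coeff_zero_X_mul, coeff_derivative, h0] at this
    simpa using this
  have h2 : ∀ n, coeff (n + 2) E = 0 := by
    intro n
    induction n using Nat.strong_induction_on with | _ n ih =>
    have hn : ((n : 𝕜) + 1 + 1) ≠ 0 := by exact_mod_cast (n + 1).succ_ne_zero
    refine (mul_eq_zero.1 ?_).resolve_right hn
    rw [hrec]
    cases n with
    | zero => simp
    | succ n => rw [ih n (by omega)]; simp
  ext n
  match n with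
  | 0 => simp [h0]
  | 1 => simp [h1, coeff_one]
  | n + 2 => simp [h2, coeff_one, coeff_X]

theorem powSum_one_add_X (f : A⟦X⟧) (hf : constantCoeff f = 0) :
    powSum 𝕜 (fun n => coeff n (1 + X : 𝕜⟦X⟧)) f = 1 + f := by
  refine eq_of_eqBelow fun N => (powSum_eqBelow _ hf (show N ≤ N + 1 + 1 by omega)).trans ?_
  rw [Finset.sum_range_succ', Finset.sum_range_succ']
  simp [coeff_one, coeff_X, add_comm, EqBelow.refl]

theorem psExp_psLog [CharZero 𝕜] {g : A⟦X⟧} (hg : constantCoeff g = 1) :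
    psExp 𝕜 (psLog 𝕜 g) = g := by
  have hg' : constantCoeff (g - 1) = 0 := by simp [hg]
  have h : psLog 𝕜 g = powSum 𝕜 (fun n => coeff n (psLog 𝕜 (1 + X : 𝕜⟦X⟧))) (g - 1) := by
    rw [psLog, psLog, add_sub_cancel_left]
    congr 1
    ext n
    simp [powSum, coeff_X_pow]
  rw [h, psExp, powSum_powSum _ (constantCoeff_psLog _) hg']
  have := psExp_psLog_one_add_X (𝕜 := 𝕜)
  rw [psExp] at this
  rw [this, powSum_one_add_X _ hg', add_sub_cancel]

theorem psLog_psExp [CharZero 𝕜] {f : A⟦X⟧} (hf : constantCoeff f = 0) :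
    psLog 𝕜 (psExp 𝕜 f) = f :=
  psExp_injective (𝕜 := 𝕜) (constantCoeff_psLog _) hf (psExp_psLog (constantCoeff_psExp f))

theorem constantCoeff_CBHD {x y : A⟦X⟧} (hx : constantCoeff x = 0) (hy : constantCoeff y = 0) :
    constantCoeff (CBHD 𝕜 x y) = 0 := by
  simp [CBHD, constantCoeff_psLog, hx, hy]

/-- CBHD is a combination of parts of order at least two of exponentials and a product of two series
without constant term; each of these gains a power of t. -/
theorem CBHD_congr [CharZero 𝕜] {N : ℕ} {x x' y y' : A⟦X⟧} (hx : constantCoeff x = 0)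
    (hx' : constantCoeff x' = 0) (hy : constantCoeff y = 0) (hy' : constantCoeff y' = 0)
    (h : EqBelow N x x') (h' : EqBelow N y y') :
    EqBelow (N + 1) (CBHD 𝕜 x y) (CBHD 𝕜 x' y') := by
  have key : ∀ x y : A⟦X⟧, CBHD 𝕜 x y = (psExp 𝕜 x - 1 - x) + (psExp 𝕜 y - 1 - y) +
      (psExp 𝕜 x - 1) * (psExp 𝕜 y - 1) -
      (psExp 𝕜 (psLog 𝕜 (psExp 𝕜 x * psExp 𝕜 y)) - 1 - psLog 𝕜 (psExp 𝕜 x * psExp 𝕜 y)) := by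
    intro x y
    rw [psExp_psLog (by simp [constantCoeff_psExp]), CBHD]
    noncomm_ring
  have hE : ∀ x : A⟦X⟧, constantCoeff (psExp 𝕜 x - 1) = 0 := by simp [constantCoeff_psExp]
  rw [key x y, key x' y']
  refine (((psExp_sub_congr hx hx' h).add (psExp_sub_congr hy hy' h')).add
    (EqBelow.mul_succ (hE _) (hE _) ((psExp_congr h).sub (EqBelow.refl _ 1))
      ((psExp_congr h').sub (EqBelow.refl _ 1)))).sub
    (psExp_sub_congr (constantCoeff_psLog _) (constantCoeff_psLog _)
      (psLog_congr ((psExp_congr h).mul (psExp_congr h'))))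

end ExpLog

/-! ### Sums over compositions and Lam's exponent. -/

section Lam

variable (𝕜 : Type*) [Field 𝕜] {A : Type*} [Ring A] [Algebra 𝕜 A]

/-- The series with coefficients
`∑ C_{k₁} ⋯ C_{kₗ} / (kₗ (kₗ₋₁ + kₗ) ⋯ (k₁ + ⋯ + kₗ))`. -/
noncomputable def compositionSeries (C : ℕ → A) : A⟦X⟧ :=
  PowerSeries.mk fun n => ∑ c : Composition n, compWeight 𝕜 c.blocks • (c.blocks.map C).prod

theorem constantCoeff_compositionSeries (C : ℕ → A) :
    constantCoeff (compositionSeries 𝕜 C) = 1 := by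
  have h : ∀ c : Composition 0, c.blocks = [] := fun c => c.blocks_eq_nil.2 rfl
  rw [← coeff_zero_eq_constantCoeff_apply, compositionSeries, coeff_mk]
  simp [h, compWeight, composition_card]

/-- Removing the first block of a composition. -/
theorem sum_composition_succ {M : Type*} [AddCommMonoid M] (n : ℕ) (F : List ℕ → M) :
    ∑ c : Composition (n + 1), F c.blocks =
      ∑ k ∈ Finset.range (n + 1), ∑ c : Composition (n - k), F ((k + 1) :: c.blocks) := by
  let g : (Σ k : Fin (n + 1), Composition (n - k)) → Composition (n + 1) := fun p =>
    ⟨(p.1 + 1) :: p.2.blocks, fun {i} hi => by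
      rcases List.mem_cons.1 hi with rfl | hi
      · omega
      · exact p.2.blocks_pos hi, by
      rw [List.sum_cons, p.2.blocks_sum]
      omega⟩
  have hg : Function.Bijective g := by
    constructor
    · rintro ⟨k, c⟩ ⟨k', c'⟩ h
      have h' : ((k : ℕ) + 1) :: c.blocks = ((k' : ℕ) + 1) :: c'.blocks :=
        congrArg Composition.blocks h
      rw [List.cons.injEq] at h'
      obtain rfl : k = k' := Fin.ext (by omega)
      rw [Composition.ext h'.2]
    · rintro ⟨l, hl, hs⟩
      rcases l with _ | ⟨k, l⟩
      · simp at hs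
      · have hk : 0 < k := hl (by simp)
        rw [List.sum_cons] at hs
        refine ⟨⟨⟨k - 1, by omega⟩, ⟨l, fun {i} hi => hl (List.mem_cons_of_mem _ hi), ?_⟩⟩, ?_⟩
        · simp only
          omega
        · refine Composition.ext ?_
          simp only [g, List.cons.injEq, and_true]
          omega
  rw [← Fin.sum_univ_eq_sum_range
    (fun k => ∑ c : Composition (n - k), F ((k + 1) :: c.blocks)) (n + 1),
    ← hg.sum_comp, Fintype.sum_sigma]

/-- The outermost factor of a weight is the inverse of the full sum n + 1. Multiplying by n + 1
cancels it and leaves the weight of the composition without its first block. -/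
theorem coeff_compositionSeries_succ [CharZero 𝕜] (C : ℕ → A) (n : ℕ) :
    ((n + 1 : ℕ) : 𝕜) • coeff (n + 1) (compositionSeries 𝕜 C) =
      ∑ k ∈ Finset.range (n + 1), C (k + 1) * coeff (n - k) (compositionSeries 𝕜 C) := by
  have hn : ((n + 1 : ℕ) : 𝕜) ≠ 0 := by exact_mod_cast n.succ_ne_zero
  simp only [compositionSeries, coeff_mk]
  rw [sum_composition_succ n (fun l => compWeight 𝕜 l • (l.map C).prod), Finset.smul_sum]
  refine Finset.sum_congr rfl fun k hk => ?_
  rw [Finset.smul_sum, Finset.mul_sum]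
  refine Finset.sum_congr rfl fun c _ => ?_
  have hk' : k + 1 + (n - k) = n + 1 := by simp only [Finset.mem_range] at hk; omega
  rw [compWeight, c.blocks_sum, hk', smul_smul, mul_inv_cancel_left₀ hn, List.map_cons,
    List.prod_cons, mul_smul_comm]

variable {𝕜}

theorem eq_compositionSeries [CharZero 𝕜] {C : ℕ → A} {f : A⟦X⟧} (h0 : constantCoeff f = 1)
    (hf : ∀ n : ℕ, ((n + 1 : ℕ) : 𝕜) • coeff (n + 1) f =
      ∑ k ∈ Finset.range (n + 1), C (k + 1) * coeff (n - k) f) :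
    f = compositionSeries 𝕜 C := by
  ext n
  induction n using Nat.strong_induction_on with | _ n ih =>
  cases n with
  | zero => simp [h0, constantCoeff_compositionSeries]
  | succ n =>
    have hn : ((n + 1 : ℕ) : 𝕜) ≠ 0 := by exact_mod_cast n.succ_ne_zero
    refine smul_right_injective A hn ?_
    simp only
    rw [hf, coeff_compositionSeries_succ]
    exact Finset.sum_congr rfl fun k _ => by rw [ih _ (by omega)]

theorem map_powSum {B : Type*} [Ring B] [Algebra 𝕜 B] (φ : A →ₐ[𝕜] B) (c : ℕ → 𝕜) (f : A⟦X⟧) :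
    PowerSeries.map (φ : A →+* B) (powSum 𝕜 c f) = powSum 𝕜 c (PowerSeries.map (φ : A →+* B) f) := by
  ext n
  simp [powSum, ← map_pow]

/-- The degree-i coefficient of the logarithm sees only compositions of integers at most i, whose
blocks are at most i. Working in i variables therefore loses nothing. -/
theorem lamKSeries_eq (C : ℕ → A) : lamKSeries 𝕜 C = psLog 𝕜 (compositionSeries 𝕜 C) := by
  ext i
  rw [lamKSeries, coeff_mk]
  split_ifs with hi
  · subst hi
    simp [constantCoeff_psLog]
  set φ := FreeAlgebra.lift 𝕜 (fun j : Fin i => C (j + 1)) with hφ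
  have h1 : lamK (𝕜 := 𝕜) C i =
      coeff i (psLog 𝕜 (PowerSeries.map (φ : FreeAlgebra 𝕜 (Fin i) →+* A) (lamSeries 𝕜 i))) := by
    have : PowerSeries.map (φ : FreeAlgebra 𝕜 (Fin i) →+* A) (psLog 𝕜 (lamSeries 𝕜 i)) =
        psLog 𝕜 (PowerSeries.map (φ : FreeAlgebra 𝕜 (Fin i) →+* A) (lamSeries 𝕜 i)) := by
      simp only [psLog, map_powSum, map_sub, map_one]
    rw [← this, coeff_map]
    rfl
  rw [h1]
  refine psLog_congr (N := i + 1) (fun n hn => ?_) i (by omega)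
  rw [coeff_map, lamSeries, compositionSeries, coeff_mk, coeff_mk, RingHom.coe_coe, map_sum]
  refine Finset.sum_congr rfl fun c _ => ?_
  rw [map_smul, map_list_prod, List.map_map]
  congr 2
  refine List.map_congr_left fun k hk => ?_
  have hk1 : 1 ≤ k := c.one_le_blocks hk
  have hk2 : k ≤ n := c.blocks_le hk
  have hk3 : 1 ≤ k ∧ k ≤ i := ⟨hk1, by omega⟩
  simp [lamVar, hk3, hφ]

end Lam

/-! ### Rota-Baxter words and pre-Lie words. -/

section Series

variable {𝕜 : Type*} [Field 𝕜] {A : Type*} [Ring A] [Algebra 𝕜 A]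

/-- `onSeries` as a linear map. -/
noncomputable def onSeriesLin (R : A →ₗ[𝕜] A) : A⟦X⟧ →ₗ[𝕜] A⟦X⟧ where
  toFun := onSeries R
  map_add' f g := by ext n; simp [onSeries]
  map_smul' c f := by ext n; simp [onSeries]

theorem onSeriesLin_apply (R : A →ₗ[𝕜] A) (f : A⟦X⟧) : onSeriesLin R f = onSeries R f := rfl

theorem coeff_onSeries (R : A →ₗ[𝕜] A) (f : A⟦X⟧) (n : ℕ) :
    coeff n (onSeries R f) = R (coeff n f) := coeff_mk _ _

theorem constantCoeff_onSeries (R : A →ₗ[𝕜] A) {f : A⟦X⟧} (hf : constantCoeff f = 0) :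
    constantCoeff (onSeries R f) = 0 := by
  rw [← coeff_zero_eq_constantCoeff_apply, coeff_onSeries]
  simp [hf]

theorem EqBelow.onSeries {N : ℕ} {f g : A⟦X⟧} (h : EqBelow N f g) (R : A →ₗ[𝕜] A) :
    EqBelow N (onSeries R f) (onSeries R g) := fun i hi => by
  rw [coeff_onSeries, coeff_onSeries, h i hi]

theorem IsRotaBaxter.onSeriesLin {θ : 𝕜} {R : A →ₗ[𝕜] A} (hR : IsRotaBaxter θ R) :
    IsRotaBaxter θ (onSeriesLin R) := by
  intro f g
  ext n
  simp only [onSeriesLin_apply, map_sub, map_add, coeff_smul, coeff_onSeries, coeff_mul, map_sum,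
    Finset.smul_sum, ← Finset.sum_add_distrib, ← Finset.sum_sub_distrib]
  exact Finset.sum_congr rfl fun p _ => hR _ _

/-- The Rota-Baxter words are determined by their recursion. -/
theorem eq_mk_rbWord (R : A →ₗ[𝕜] A) (a : A) {f : A⟦X⟧}
    (hf : f = 1 + onSeries R (C a * X * f)) : f = PowerSeries.mk (rbWord R a) := by
  ext n
  induction n with
  | zero =>
    rw [hf, map_add, coeff_onSeries, mul_assoc, coeff_C_mul, coeff_zero_X_mul]
    simp [rbWord]
  | succ n ih =>
    rw [hf, map_add, coeff_onSeries, mul_assoc, coeff_C_mul, coeff_succ_X_mul, ih]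
    simp [rbWord, coeff_one]

theorem mk_rbWord (R : A →ₗ[𝕜] A) (a : A) :
    PowerSeries.mk (rbWord R a) = 1 + onSeries R (C a * X * PowerSeries.mk (rbWord R a)) := by
  ext n
  cases n with
  | zero =>
    rw [map_add, coeff_onSeries, mul_assoc, coeff_C_mul, coeff_zero_X_mul]
    simp [rbWord]
  | succ n =>
    rw [map_add, coeff_onSeries, mul_assoc, coeff_C_mul, coeff_succ_X_mul]
    simp [rbWord, coeff_one]

theorem mk_preLiePow (θ : 𝕜) (R : A →ₗ[𝕜] A) (a : A) :
    PowerSeries.mk (preLiePow θ R a) = C a * X +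
      (C a * X * onSeries R (PowerSeries.mk (preLiePow θ R a)) -
        onSeries R (PowerSeries.mk (preLiePow θ R a)) * (C a * X) +
        θ • (PowerSeries.mk (preLiePow θ R a) * (C a * X))) := by
  have h : ∀ f : A⟦X⟧, f * (C a * X) = f * C a * X := fun f => (mul_assoc _ _ _).symm
  ext n
  rcases n with _ | _ | n
  · simp [preLiePow, mul_assoc]
  · simp only [map_add, map_sub, coeff_smul, h, mul_assoc (C a) X, coeff_C_mul, coeff_succ_X_mul,
      coeff_succ_mul_X, coeff_mul_C, coeff_onSeries, coeff_mk]
    simp [preLiePow]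
  · simp only [map_add, map_sub, coeff_smul, h, mul_assoc (C a) X, coeff_C_mul, coeff_succ_X_mul,
      coeff_succ_mul_X, coeff_mul_C, coeff_onSeries, coeff_mk]
    simp [preLiePow, preLieMul]

/-- The equation t W' = R(P) W, with P the series of pre-Lie powers: both sides solve Z = R(TW +
TZ), whose right-hand side gains a power of t because T = at. -/
theorem natCast_smul_rbWord {θ : 𝕜} {R : A →ₗ[𝕜] A} (hR : IsRotaBaxter θ R) (a : A) :
    (PowerSeries.mk fun n => (n : 𝕜) • rbWord R a n) =
      PowerSeries.mk (preLieWord θ R a) * PowerSeries.mk (rbWord R a) := by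
  set W := PowerSeries.mk (rbWord R a) with hW
  set P := PowerSeries.mk (preLiePow θ R a) with hP
  set T : A⟦X⟧ := C a * X with hT
  have hT0 : constantCoeff T = 0 := by simp [hT]
  have hRP : PowerSeries.mk (preLieWord θ R a) = onSeries R P := by
    ext n
    simp [coeff_onSeries, preLieWord, hP]
  rw [hRP]
  have hWT : onSeries R (T * W) = W - 1 := by
    rw [eq_sub_iff_add_eq', hW, ← mk_rbWord]
  have hY : (PowerSeries.mk fun n => (n : 𝕜) • rbWord R a n) =
      onSeries R (T * W + T * PowerSeries.mk fun n => (n : 𝕜) • rbWord R a n) := by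
    ext n
    cases n with
    | zero => simp [coeff_onSeries, hT, mul_assoc]
    | succ n =>
      simp only [coeff_onSeries, hT, mul_assoc, map_add, coeff_C_mul, coeff_succ_X_mul, hW,
        coeff_mk, rbWord, mul_smul_comm, map_smul]
      push_cast
      rw [add_smul, one_smul, add_comm]
  have hZ : onSeries R P * W = onSeries R (T * W + T * (onSeries R P * W)) := by
    have h1 : onSeries R P * onSeries R (T * W) = onSeries R (onSeries R P * (T * W)) +
        onSeries R (P * onSeries R (T * W)) - θ • onSeries R (P * (T * W)) :=
      hR.onSeriesLin P (T * W)
    have h2 : onSeries R P * W = onSeries R P + onSeries R P * onSeries R (T * W) := by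
      rw [hWT]; noncomm_ring
    have h4 : onSeries R P * W =
        onSeries R (P + (onSeries R P * (T * W) + P * (W - 1) - θ • (P * (T * W)))) := by
      rw [h2, h1, hWT]
      simp only [← onSeriesLin_apply, ← map_smul, ← map_add, ← map_sub]
    refine h4.trans (congrArg _ ?_)
    -- The recursion of P, multiplied by W on the right. Its commutator and θ-terms cancel those of
    -- the Rota-Baxter identity in `h4`.
    have h3 : P * W = T * W + (T * onSeries R P * W - onSeries R P * T * W + θ • (P * T * W)) := by
      conv_lhs => rw [hP, mk_preLiePow]
      simp only [← hP, ← hT, add_mul, sub_mul, smul_mul_assoc]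
    rw [mul_sub, h3, ← mul_assoc T]
    simp only [← mul_assoc, mul_one]
    abel
  refine eq_of_eqBelow_succ fun N hN => ?_
  rw [hY, hZ]
  exact ((EqBelow.refl _ _).add (hN.mul_of_left hT0)).onSeries R

theorem mk_rbWord_eq_compositionSeries [CharZero 𝕜] {θ : 𝕜} {R : A →ₗ[𝕜] A}
    (hR : IsRotaBaxter θ R) (a : A) :
    PowerSeries.mk (rbWord R a) = compositionSeries 𝕜 (preLieWord θ R a) := by
  refine eq_compositionSeries (by simp [← coeff_zero_eq_constantCoeff_apply, rbWord]) fun n => ?_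
  have := congrArg (coeff (n + 1)) (natCast_smul_rbWord hR a)
  rw [coeff_mk, coeff_mul, Finset.Nat.sum_antidiagonal_eq_sum_range_succ
    (fun i j => coeff i (PowerSeries.mk (preLieWord θ R a)) *
      coeff j (PowerSeries.mk (rbWord R a))), Finset.sum_range_succ'] at this
  simpa [preLieWord, preLiePow] using this

/-- Lam's exponential Ansatz. -/
theorem psExp_lamKSeries [CharZero 𝕜] {θ : 𝕜} {R : A →ₗ[𝕜] A} (hR : IsRotaBaxter θ R) (a : A) :
    psExp 𝕜 (lamKSeries 𝕜 (preLieWord θ R a)) = PowerSeries.mk (rbWord R a) := by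
  rw [lamKSeries_eq, psExp_psLog (constantCoeff_compositionSeries 𝕜 _),
    mk_rbWord_eq_compositionSeries hR]

theorem constantCoeff_lamKSeries (C : ℕ → A) : constantCoeff (lamKSeries 𝕜 C) = 0 := by
  rw [lamKSeries_eq, constantCoeff_psLog]

end Series

/-! ### The double product. -/

section Star

variable {𝕜 : Type*} [Field 𝕜] {B : Type*} [Ring B] [Algebra 𝕜 B]

/-- The powers `x, x ∗ x, (x ∗ x) ∗ x, …` for the double product
`x ∗ y = R x * y + x * R y - θ x y`. -/
def starPow (θ : 𝕜) (R : B →ₗ[𝕜] B) (x : B) : ℕ → B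
  | 0 => x
  | k + 1 => R (starPow θ R x k) * x + starPow θ R x k * R x - θ • (starPow θ R x k * x)

/-- The Rota-Baxter identity says that R is multiplicative for the double product. Index k carries k
+ 1 factors, as no unit is available. -/
theorem map_starPow {θ : 𝕜} {R : B →ₗ[𝕜] B} (hR : IsRotaBaxter θ R) (x : B) (k : ℕ) :
    R (starPow θ R x k) = R x ^ (k + 1) := by
  induction k with
  | zero => simp [starPow]
  | succ k ih => rw [pow_succ, ← ih, hR, starPow, map_sub, map_add, map_smul]

/-- `R - θ id` is a Rota-Baxter map of weight `-θ`. -/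
theorem IsRotaBaxter.sub_smul_id {θ : 𝕜} {R : B →ₗ[𝕜] B} (hR : IsRotaBaxter θ R) :
    IsRotaBaxter (-θ) (R - θ • LinearMap.id) := by
  intro x y
  have := hR x y
  simp only [LinearMap.sub_apply, LinearMap.smul_apply, LinearMap.id_apply, sub_mul, mul_sub,
    smul_mul_assoc, mul_smul_comm, map_sub, map_smul, smul_sub, neg_smul, this]
  abel

theorem starPow_sub_smul_id (θ : 𝕜) (R : B →ₗ[𝕜] B) (x : B) (k : ℕ) :
    starPow (-θ) (R - θ • LinearMap.id) x k = starPow θ R x k := by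
  induction k with
  | zero => rfl
  | succ k ih =>
    simp only [starPow, ih, LinearMap.sub_apply, LinearMap.smul_apply, LinearMap.id_apply, sub_mul,
      mul_sub, smul_mul_assoc, mul_smul_comm, neg_smul]
    abel

/-- In weight zero, the powers for the double product are the derivatives at `x` of the powers
of `R x`. -/
theorem starPow_zero {R : B →ₗ[𝕜] B} (hR : IsRotaBaxter (0 : 𝕜) R) (x : B) (k : ℕ) :
    starPow (0 : 𝕜) R x k = ∑ p ∈ Finset.HasAntidiagonal.antidiagonal k,
      ((k + 1).choose (p.1 + 1)) •
        (((LinearMap.mulLeft 𝕜 (R x) - LinearMap.mulRight 𝕜 (R x)) ^ p.1) x * R x ^ p.2) := by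
  set D := LinearMap.mulLeft 𝕜 (R x) - LinearMap.mulRight 𝕜 (R x) with hD
  -- Left multiplication is D plus right multiplication, and these commute, so the binomial theorem
  -- applies.
  have hpow : ∀ k, R x ^ k * x = ∑ p ∈ Finset.HasAntidiagonal.antidiagonal k,
      (k.choose p.1) • ((D ^ p.1) x * R x ^ p.2) := by
    intro k
    have hc : Commute D (LinearMap.mulRight 𝕜 (R x)) :=
      ((LinearMap.commute_mulLeft_right _ _).sub_left (Commute.refl _))
    have h := congrArg (fun T : Module.End 𝕜 B => T x) (hc.add_pow' k)
    simp only [hD, sub_add_cancel] at h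
    rw [LinearMap.pow_mulLeft, LinearMap.mulLeft_apply, ← hD] at h
    rw [h, LinearMap.sum_apply]
    refine Finset.sum_congr rfl fun p _ => ?_
    rw [(hc.pow_pow p.1 p.2).eq, LinearMap.smul_apply, Module.End.mul_apply,
      LinearMap.pow_mulRight, LinearMap.mulRight_apply]
  induction k with
  | zero => simp [starPow]
  | succ k ih =>
    rw [starPow, map_starPow hR, zero_smul, sub_zero, hpow, ih, Finset.sum_mul]
    -- Pascal's rule matches the two halves with R(x^{∗(k+1)}) x and x^{∗(k+1)} R(x).
    simp only [Nat.choose_succ_succ (k + 1), add_smul, Finset.sum_add_distrib]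
    congr 1
    rw [Finset.Nat.sum_antidiagonal_succ', Nat.choose_succ_self, zero_smul, zero_add]
    simp only [smul_mul_assoc, mul_assoc, ← pow_succ]

end Star

/-! ### Exponentials through the double product. -/

section Exp

variable {𝕜 : Type*} [Field 𝕜] {A : Type*} [Ring A] [Algebra 𝕜 A]

/-- The exponential of `x` for the double product, without its constant term. -/
noncomputable def starExp (θ : 𝕜) (R : A →ₗ[𝕜] A) (x : A⟦X⟧) : A⟦X⟧ :=
  PowerSeries.mk fun n => ∑ k ∈ Finset.range (n + 1),
    (((k + 1).factorial : ℕ) : 𝕜)⁻¹ • coeff n (starPow θ (onSeriesLin R) x k)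

theorem psExp_onSeries {θ : 𝕜} {R : A →ₗ[𝕜] A} (hR : IsRotaBaxter θ R) {x : A⟦X⟧}
    (hx : constantCoeff x = 0) :
    psExp 𝕜 (onSeries R x) = 1 + onSeries R (starExp θ R x) := by
  have hx' := constantCoeff_onSeries R hx
  ext n
  -- One extra term is kept, so that splitting off k = 0 leaves the truncation used in `starExp`.
  have h := powSum_eqBelow (fun k => ((k.factorial : ℕ) : 𝕜)⁻¹) hx'
    (show n + 1 ≤ n + 1 + 1 by omega) n (by omega)
  rw [psExp, h, Finset.sum_range_succ', map_add, add_comm, map_add, coeff_onSeries, starExp,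
    coeff_mk, map_sum, map_sum]
  congr 1
  · simp
  · refine Finset.sum_congr rfl fun k _ => ?_
    rw [coeff_smul, R.map_smul, ← coeff_onSeries, ← onSeriesLin_apply, ← onSeriesLin_apply,
      map_starPow hR.onSeriesLin]

theorem onSeriesLin_sub_smul_id (θ : 𝕜) (R : A →ₗ[𝕜] A) :
    onSeriesLin (R - θ • LinearMap.id) = onSeriesLin R - θ • LinearMap.id := by
  ext f n
  simp [onSeriesLin_apply, coeff_onSeries]

theorem psExp_onSeries_sub {θ : 𝕜} {R : A →ₗ[𝕜] A} (hR : IsRotaBaxter θ R) {x : A⟦X⟧}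
    (hx : constantCoeff x = 0) :
    psExp 𝕜 (onSeries R x - θ • x) = 1 + (onSeries R (starExp θ R x) - θ • starExp θ R x) := by
  have h := psExp_onSeries hR.sub_smul_id hx
  have h' : starExp (-θ) (R - θ • LinearMap.id) x = starExp θ R x := by
    simp only [starExp, onSeriesLin_sub_smul_id, starPow_sub_smul_id]
  rw [h', ← onSeriesLin_apply, ← onSeriesLin_apply, onSeriesLin_sub_smul_id] at h
  exact h

theorem onSeriesTilde_eq (θ : 𝕜) (R : A →ₗ[𝕜] A) (f : A⟦X⟧) :
    onSeriesTilde θ R f = θ • f - onSeries R f := by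
  ext n
  simp [onSeriesTilde, coeff_onSeries]

theorem constantCoeff_smul_eq_zero (c : 𝕜) {f : A⟦X⟧} (hf : constantCoeff f = 0) :
    constantCoeff (c • f) = 0 := by
  rw [← coeff_zero_eq_constantCoeff_apply, coeff_smul]
  simp [hf]

end Exp

/-! ### The recursion in nonzero weight. -/

section NonzeroWeight

variable {𝕜 : Type*} [Field 𝕜] [CharZero 𝕜] {A : Type*} [Ring A] [Algebra 𝕜 A]

theorem chi_spec (θ : 𝕜) (R : A →ₗ[𝕜] A) {u : A⟦X⟧} (hu : constantCoeff u = 0) :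
    TAdicTendsto (chiIter θ R u) (chi θ R u) ∧ constantCoeff (chi θ R u) = 0 ∧
      chi θ R u =
        u - θ⁻¹ • CBHD 𝕜 (onSeriesTilde θ R (chi θ R u)) (onSeries R (chi θ R u)) := by
  refine tendsto_tAdicLim_and_fixed
    (F := fun f => u - θ⁻¹ • CBHD 𝕜 (onSeriesTilde θ R f) (onSeries R f)) ?_ ?_ hu fun _ => rfl
  · intro f hf
    have := constantCoeff_CBHD (𝕜 := 𝕜) (constantCoeff_onSeries (θ • LinearMap.id - R) hf)
      (constantCoeff_onSeries R hf)
    rw [← coeff_zero_eq_constantCoeff_apply] at this ⊢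
    rw [map_sub, coeff_smul, onSeriesTilde, this]
    simp [hu]
  · intro N f g hf hg h
    exact (EqBelow.refl _ _).sub ((CBHD_congr (constantCoeff_onSeries _ hf)
      (constantCoeff_onSeries _ hg) (constantCoeff_onSeries _ hf) (constantCoeff_onSeries _ hg)
      (h.onSeries _) (h.onSeries _)).smul _)

theorem psExp_CBHD {x y : A⟦X⟧} : psExp 𝕜 (x + y + CBHD 𝕜 x y) = psExp 𝕜 x * psExp 𝕜 y := by
  rw [CBHD, show x + y + (psLog 𝕜 (psExp 𝕜 x * psExp 𝕜 y) - x - y) =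
    psLog 𝕜 (psExp 𝕜 x * psExp 𝕜 y) by abel, psExp_psLog (by simp [constantCoeff_psExp])]

theorem CBHD_eq_of_psExp_mul {x y z : A⟦X⟧} (hz : constantCoeff z = 0)
    (h : psExp 𝕜 z = psExp 𝕜 x * psExp 𝕜 y) : CBHD 𝕜 x y = z - x - y := by
  rw [CBHD, ← h, psLog_psExp hz]

/-- Atkinson's factorization of `1 - θ a t`. -/
theorem psExp_neg_onSeries_chi {θ : 𝕜} (hθ : θ ≠ 0) {R : A →ₗ[𝕜] A} (hR : IsRotaBaxter θ R)
    (a : A) {χ : A⟦X⟧} (h0 : constantCoeff χ = 0)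
    (h : χ = θ⁻¹ • psLog 𝕜 (1 - θ • (C a * X)) -
      θ⁻¹ • CBHD 𝕜 (onSeriesTilde θ R χ) (onSeries R χ)) :
    psExp 𝕜 (-onSeries R χ) = PowerSeries.mk (rbWord R a) := by
  have hx : constantCoeff (-χ) = 0 := by simp [h0]
  have h1 : psExp 𝕜 (onSeriesTilde θ R χ) * psExp 𝕜 (onSeries R χ) = 1 - θ • (C a * X) := by
    have : θ • χ + CBHD 𝕜 (onSeriesTilde θ R χ) (onSeries R χ) = psLog 𝕜 (1 - θ • (C a * X)) := by
      conv_lhs => enter [1]; rw [h]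
      rw [smul_sub, smul_inv_smul₀ hθ, smul_inv_smul₀ hθ, sub_add_cancel]
    rw [← psExp_CBHD, onSeriesTilde_eq, sub_add_cancel, ← onSeriesTilde_eq, this, psExp_psLog]
    rw [map_sub, constantCoeff_smul_eq_zero θ (by simp)]
    simp
  have hR0 := constantCoeff_onSeries R h0
  have h2 : psExp 𝕜 (onSeriesTilde θ R χ) =
      (1 - θ • (C a * X)) * psExp 𝕜 (-onSeries R χ) := by
    rw [← h1, mul_assoc, psExp_mul_psExp_neg hR0, mul_one]
  have h3 : -onSeries R χ = onSeries R (-χ) := by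
    rw [← onSeriesLin_apply, ← onSeriesLin_apply, map_neg]
  have h4 : onSeriesTilde θ R χ = onSeries R (-χ) - θ • (-χ) := by
    rw [onSeriesTilde_eq, ← h3, smul_neg]; abel
  have h5 := psExp_onSeries hR hx
  rw [h4, psExp_onSeries_sub hR hx, h3, sub_mul, one_mul, smul_mul_assoc] at h2
  -- Comparing `h2` with `h5`, everything cancels except the two terms with factor θ, which is then
  -- divided out.
  have h6 : starExp θ R (-χ) = C a * X * psExp 𝕜 (onSeries R (-χ)) := by
    refine smul_right_injective _ hθ ?_
    simp only
    rw [← sub_eq_zero] at h2 ⊢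
    rw [← neg_eq_zero, ← h2]
    nth_rw 2 [h5]
    abel
  rw [h3]
  refine eq_mk_rbWord R a ?_
  rw [← h6]
  exact h5

theorem theta_recursion {θ : 𝕜} (hθ : θ ≠ 0) {R : A →ₗ[𝕜] A} (hR : IsRotaBaxter θ R)
    (a : A) {u χ : A⟦X⟧} (hu : u = θ⁻¹ • psLog 𝕜 (1 - θ • (C a * X)))
    (h0 : constantCoeff χ = 0)
    (h : χ = u - θ⁻¹ • CBHD 𝕜 (onSeriesTilde θ R χ) (onSeries R χ)) :
    lamKSeries 𝕜 (preLieWord θ R a) = -onSeries R χ ∧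
      χ = u + θ⁻¹ • CBHD 𝕜 (θ • u) (lamKSeries 𝕜 (preLieWord θ R a)) := by
  have hR0 := constantCoeff_onSeries R h0
  have hK : lamKSeries 𝕜 (preLieWord θ R a) = -onSeries R χ := by
    refine psExp_injective (𝕜 := 𝕜) (constantCoeff_lamKSeries _) (by simp [hR0]) ?_
    rw [psExp_lamKSeries hR, psExp_neg_onSeries_chi hθ hR a h0 (hu ▸ h)]
  refine ⟨hK, ?_⟩
  have h1 : θ • χ + CBHD 𝕜 (onSeriesTilde θ R χ) (onSeries R χ) = θ • u := by
    conv_lhs => enter [1]; rw [h]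
    rw [smul_sub, smul_inv_smul₀ hθ, sub_add_cancel]
  have h2 : psExp 𝕜 (onSeriesTilde θ R χ) = psExp 𝕜 (θ • u) * psExp 𝕜 (-onSeries R χ) := by
    rw [← h1]
    conv_rhs => enter [1, 2, 1]; rw [← sub_add_cancel (θ • χ) (onSeries R χ), ← onSeriesTilde_eq]
    rw [psExp_CBHD, mul_assoc, psExp_mul_psExp_neg hR0, mul_one]
  have h3 : constantCoeff (onSeriesTilde θ R χ) = 0 := constantCoeff_onSeries _ h0
  rw [hK, CBHD_eq_of_psExp_mul h3 h2, onSeriesTilde_eq, smul_sub, smul_sub, smul_sub,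
    inv_smul_smul₀ hθ, inv_smul_smul₀ hθ, smul_neg]
  abel

end NonzeroWeight

/-! ### The recursion in weight zero. -/

section ZeroWeight

variable {𝕜 : Type*} [Field 𝕜] {A : Type*} [Ring A] [Algebra 𝕜 A]

theorem adBernoulli_eq_opSum [CharZero 𝕜] (x u : A⟦X⟧) :
    adBernoulli 𝕜 x u = opSum (fun n => coeff n (bernoulliPowerSeries 𝕜))
      (LinearMap.mulLeft 𝕜 x - LinearMap.mulRight 𝕜 x) u := by
  ext n
  simp only [adBernoulli, opSum, coeff_mk, bernoulliPowerSeries, Module.End.pow_apply]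
  refine Finset.sum_congr rfl fun k _ => ?_
  rw [eq_ratCast]
  rfl

theorem mk_inv_factorial_succ_mul_bernoulliPowerSeries [CharZero 𝕜] :
    (PowerSeries.mk fun m => (((m + 1).factorial : ℕ) : 𝕜)⁻¹) * bernoulliPowerSeries 𝕜 = 1 := by
  have h : PowerSeries.exp 𝕜 - 1 = X * PowerSeries.mk fun m => (((m + 1).factorial : ℕ) : 𝕜)⁻¹ := by
    ext n
    cases n with
    | zero => simp
    | succ n => rw [coeff_succ_X_mul]; simp [coeff_exp, coeff_one]
  have h' := bernoulliPowerSeries_mul_exp_sub_one 𝕜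
  rw [h] at h'
  refine mul_left_cancel₀ (X_ne_zero (R := 𝕜)) ?_
  rw [mul_one]
  nth_rw 2 [← h']
  ring

/-- This is the derivative of exp at R(x) in the direction x. It follows from `starPow_zero`, since
binom(p+q+1, p+1)/(p+q+1)! = 1/((p+1)! q!) separates the double sum. -/
theorem starExp_zero [CharZero 𝕜] {R : A →ₗ[𝕜] A} (hR : IsRotaBaxter (0 : 𝕜) R) {x : A⟦X⟧}
    (hx : constantCoeff x = 0) :
    starExp (0 : 𝕜) R x = opSum (fun m => (((m + 1).factorial : ℕ) : 𝕜)⁻¹)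
      (LinearMap.mulLeft 𝕜 (onSeries R x) - LinearMap.mulRight 𝕜 (onSeries R x)) x *
        psExp 𝕜 (onSeries R x) := by
  have hx' := constantCoeff_onSeries R hx
  have hraise := raises_ad (𝕜 := 𝕜) hx'
  ext n
  rw [psExp, ((opSum_eqBelow (fun m => (((m + 1).factorial : ℕ) : 𝕜)⁻¹) hraise x (le_refl (n + 1))).mul
    (powSum_eqBelow (fun k => ((k.factorial : ℕ) : 𝕜)⁻¹) hx' (le_refl (n + 1)))) n (by omega),
    Finset.sum_mul_sum, map_sum]
  simp only [map_sum, smul_mul_smul_comm, coeff_smul]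
  rw [sum_range_sum_range_eq_sum_antidiagonal, starExp, coeff_mk]
  · refine Finset.sum_congr rfl fun k _ => ?_
    rw [starPow_zero hR.onSeriesLin, map_sum, Finset.smul_sum]
    refine Finset.sum_congr rfl fun p hp => ?_
    rw [Finset.HasAntidiagonal.mem_antidiagonal] at hp
    rw [map_nsmul, ← Nat.cast_smul_eq_nsmul 𝕜, smul_smul, onSeriesLin_apply]
    congr 1
    rw [← hp, show p.1 + p.2 + 1 = p.1 + 1 + p.2 by ring, Nat.cast_add_choose]
    have h1 : (((p.1 + 1 + p.2).factorial : ℕ) : 𝕜) ≠ 0 := by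
      exact_mod_cast Nat.factorial_ne_zero _
    have h2 : (((p.1 + 1).factorial : ℕ) : 𝕜) ≠ 0 := by exact_mod_cast Nat.factorial_ne_zero _
    have h3 : ((p.2.factorial : ℕ) : 𝕜) ≠ 0 := by exact_mod_cast Nat.factorial_ne_zero _
    field_simp
  · intro i j hij
    have h1 := hraise.pow (N := 0) (f := x) (g := 0) (fun i hi => by omega) i
    -- The i commutators contribute order i and the j factors R(x) order j, so the square of indices
    -- reduces to a triangle.
    have h2 : EqBelow (i + j) (((LinearMap.mulLeft 𝕜 (onSeries R x) -
        LinearMap.mulRight 𝕜 (onSeries R x)) ^ i) x * onSeries R x ^ j) 0 := by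
      intro m hm
      rw [coeff_mul, map_zero]
      refine Finset.sum_eq_zero fun q hq => ?_
      rw [Finset.HasAntidiagonal.mem_antidiagonal] at hq
      rcases lt_or_ge q.1 i with h | h
      · rw [h1 q.1 (by omega), map_zero, map_zero, zero_mul]
      · rw [coeff_of_lt_order q.2, mul_zero]
        exact lt_of_lt_of_le (by exact_mod_cast (by omega : q.2 < j))
          (le_order_pow_of_constantCoeff_eq_zero j hx')
    rw [h2 n hij, map_zero, smul_zero]

theorem constantCoeff_adBernoulli (x : A⟦X⟧) {u : A⟦X⟧} (hu : constantCoeff u = 0) :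
    constantCoeff (adBernoulli 𝕜 x u) = 0 := by
  rw [← coeff_zero_eq_constantCoeff_apply, adBernoulli, coeff_mk]
  simp [hu]

/-- The gain comes from `u` having no constant term: every iterated commutator multiplies the
difference of x and y by a series divisible by t. -/
theorem adBernoulli_congr [CharZero 𝕜] {N : ℕ} {x y u : A⟦X⟧} (hx : constantCoeff x = 0)
    (hy : constantCoeff y = 0) (hu : constantCoeff u = 0) (h : EqBelow N x y) :
    EqBelow (N + 1) (adBernoulli 𝕜 x u) (adBernoulli 𝕜 y u) := by
  rw [adBernoulli_eq_opSum, adBernoulli_eq_opSum]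
  refine (opSum_eqBelow _ (raises_ad hx) u le_rfl).trans (EqBelow.trans
    (EqBelow.sum fun k hk => EqBelow.smul _ ?_) (opSum_eqBelow _ (raises_ad hy) u le_rfl).symm)
  have hc : ∀ k, constantCoeff
      (((LinearMap.mulLeft 𝕜 y - LinearMap.mulRight 𝕜 y) ^ k) u) = 0 := by
    intro k
    cases k with
    | zero => simpa using hu
    | succ k => simp [pow_succ', hy]
  clear hk
  induction k with
  | zero => exact EqBelow.refl _ _
  | succ k ih =>
    simp only [pow_succ', Module.End.mul_apply, LinearMap.sub_apply, LinearMap.mulLeft_apply,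
      LinearMap.mulRight_apply]
    have ih' := ih.mono (Nat.le_succ N)
    have hc' : constantCoeff (((LinearMap.mulLeft 𝕜 x - LinearMap.mulRight 𝕜 x) ^ k) u) = 0 := by
      rw [ih.constantCoeff_eq, hc]
    exact (EqBelow.mul_succ hy hc' h ih').sub (EqBelow.mul_succ (hc k) hx ih' h)

theorem chiZero_spec [CharZero 𝕜] (R : A →ₗ[𝕜] A) {u : A⟦X⟧} (hu : constantCoeff u = 0) :
    TAdicTendsto (chiZeroIter R u) (chiZero R u) ∧ constantCoeff (chiZero R u) = 0 ∧
      chiZero R u = adBernoulli 𝕜 (onSeries R (chiZero R u)) u :=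
  tendsto_tAdicLim_and_fixed (F := fun f => adBernoulli 𝕜 (onSeries R f) u)
    (fun _ _ => constantCoeff_adBernoulli _ hu)
    (fun _ _ _ hf hg h => adBernoulli_congr (constantCoeff_onSeries R hf)
      (constantCoeff_onSeries R hg) hu (h.onSeries R)) hu fun _ => rfl

theorem lamKSeries_eq_onSeries_of_adBernoulli [CharZero 𝕜] {R : A →ₗ[𝕜] A}
    (hR : IsRotaBaxter (0 : 𝕜) R) (a : A) {χ : A⟦X⟧} (h0 : constantCoeff χ = 0)
    (h : χ = adBernoulli 𝕜 (onSeries R χ) (C a * X)) :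
    lamKSeries 𝕜 (preLieWord (0 : 𝕜) R a) = onSeries R χ := by
  have hR0 := constantCoeff_onSeries R h0
  refine psExp_injective (𝕜 := 𝕜) (constantCoeff_lamKSeries _) hR0 ?_
  rw [psExp_lamKSeries hR]
  refine (eq_mk_rbWord R a ?_).symm
  -- Inverting the Bernoulli operator in the fixed-point equation; `starExp_zero` then identifies at
  -- exp(Rχ) with the ∗-exponential of χ.
  have h1 : opSum (fun m => (((m + 1).factorial : ℕ) : 𝕜)⁻¹)
      (LinearMap.mulLeft 𝕜 (onSeries R χ) - LinearMap.mulRight 𝕜 (onSeries R χ)) χ = C a * X := by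
    conv_lhs => enter [3]; rw [h]
    have h2 := opSum_mul (PowerSeries.mk fun m => (((m + 1).factorial : ℕ) : 𝕜)⁻¹)
      (bernoulliPowerSeries 𝕜) (raises_ad (𝕜 := 𝕜) hR0) (C a * X)
    rw [mk_inv_factorial_succ_mul_bernoulliPowerSeries, opSum_coeff_one] at h2
    simp only [coeff_mk] at h2
    rw [adBernoulli_eq_opSum, ← h2]
  rw [← h1, ← starExp_zero hR h0, ← psExp_onSeries hR h0]

end ZeroWeight

end RotaBaxter

theorem mainTheorem3 {𝕜 : Type*} [Field 𝕜] [CharZero 𝕜] {A : Type*} [Ring A] [Algebra 𝕜 A]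
    (θ : 𝕜) (R : A →ₗ[𝕜] A) (hR : RotaBaxter.IsRotaBaxter θ R) (a : A) :
    let K : PowerSeries A := RotaBaxter.lamKSeries 𝕜 (RotaBaxter.preLieWord θ R a)
    let T : PowerSeries A := PowerSeries.C a * PowerSeries.X
    -- Lam's exponential Ansatz, in every weight
    RotaBaxter.psExp 𝕜 K = PowerSeries.mk (RotaBaxter.rbWord R a) ∧
    (θ ≠ 0 →
      let u : PowerSeries A := θ⁻¹ • RotaBaxter.psLog 𝕜 (1 - θ • T)
      let χ : PowerSeries A := RotaBaxter.chi θ R u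
      -- `χ` is the limit of the recursion, and a fixed point of it
      RotaBaxter.TAdicTendsto (RotaBaxter.chiIter θ R u) χ ∧
      χ = u - θ⁻¹ • RotaBaxter.CBHD 𝕜 (RotaBaxter.onSeriesTilde θ R χ) (RotaBaxter.onSeries R χ) ∧
      K = -RotaBaxter.onSeries R χ ∧
      -- the closed solution of the recursion
      χ = u + θ⁻¹ • RotaBaxter.CBHD 𝕜 (θ • u) K) ∧
    (θ = 0 →
      let χ : PowerSeries A := RotaBaxter.chiZero R T
      RotaBaxter.TAdicTendsto (RotaBaxter.chiZeroIter R T) χ ∧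
      χ = RotaBaxter.adBernoulli 𝕜 (RotaBaxter.onSeries R χ) T ∧
      K = RotaBaxter.onSeries R χ) := by
  intro K T
  refine ⟨RotaBaxter.psExp_lamKSeries hR a, fun hθ => ?_, fun hθ => ?_⟩
  · intro u χ
    obtain ⟨h1, h2, h3⟩ := RotaBaxter.chi_spec θ R (u := u)
      (RotaBaxter.constantCoeff_smul_eq_zero _ (RotaBaxter.constantCoeff_psLog _))
    exact ⟨h1, h3, RotaBaxter.theta_recursion hθ hR a rfl h2 h3⟩
  · intro χ
    subst hθ
    obtain ⟨h1, h2, h3⟩ := RotaBaxter.chiZero_spec R (u := T) (by simp [T])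
    exact ⟨h1, h3, RotaBaxter.lamKSeries_eq_onSeries_of_adBernoulli hR a h2 h3⟩
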